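/- Call a topological space $X$: \emph{locally conical} if every point of $X$ has an open neighborhood homeomorphic to the open cone $Y\times[0,\infty)/(Y\times\{0\})$ over a compact space $Y$ (quotient topology; the point need not be the vertex of the cone); \emph{homogeneous} if for any two points $p,q\in X$ there is a homeomorphism of $X$ onto itself that maps $p$ to $q$; \emph{strongly $n$-homogeneous} if every bijection between two $n$-element subsets of $X$ extends to a homeomorphism of $X$ onto itself; \emph{countable dense homogeneous} if for any two countable dense subsets $A,B$ of $X$ there is a homeomorphism of $X$ onto itself that maps $A$ onto $B$; a \emph{Euclidean neighborhood retract} if it is homeomorphic to a retract of an open subset of $\mathbb{R}^m$ for some $m\ge 1$. Let $X$ be a locally conical homogeneous Euclidean neighborhood retract that is not a topological manifold without boundary (of any dimension $m \ge 0$); that is, let $X$ be a locally conical counterexample to the Bing--Borsuk Conjecture, which asserts that every homogeneous Euclidean neighborhood retract is a topological manifold without boundary. Then each connected component of $X$ (with the subspace topology) is strongly $n$-homogeneous for every integer $n\ge 2$, and $X$ is countable dense homogeneous. -/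

import Mathlib

open scoped NNReal

universe u

/-- The equivalence relation on `Y × [0, ∞)` that identifies all points of `Y × {0}`. -/
def openConeSetoid (Y : Type u) : Setoid (Y × ℝ≥0) where
  r p q := p = q ∨ (p.2 = 0 ∧ q.2 = 0)
  iseqv := by
    refine ⟨fun _ => Or.inl rfl, ?_, ?_⟩
    · rintro p q (h | ⟨h, h'⟩)
      · exact Or.inl h.symm
      · exact Or.inr ⟨h', h⟩
    · rintro p q r (rfl | ⟨h, h'⟩) (rfl | ⟨k, k'⟩)
      · exact Or.inl rfl
      · exact Or.inr ⟨k, k'⟩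
      · exact Or.inr ⟨h, h'⟩
      · exact Or.inr ⟨h, k'⟩

/-- The open cone over `Y`: the space `Y × [0, ∞)` with `Y × {0}` collapsed to a point (the
vertex), with the quotient topology. -/
abbrev OpenCone (Y : Type u) : Type u := Quotient (openConeSetoid Y)

/-- `X` is locally conical if every point of `X` has an open neighborhood that is homeomorphic to
the open cone over a compact space. -/
def IsLocallyConical (X : Type u) [TopologicalSpace X] : Prop :=
  ∀ x : X, ∃ U : Set X, IsOpen U ∧ x ∈ U ∧
    ∃ (Y : Type u) (_ : TopologicalSpace Y), CompactSpace Y ∧ Nonempty (U ≃ₜ OpenCone Y)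

/-- `X` is homogeneous if any point can be mapped to any other point by a self-homeomorphism. -/
def IsHomogeneousSpace (X : Type u) [TopologicalSpace X] : Prop :=
  ∀ p q : X, ∃ h : X ≃ₜ X, h p = q

/-- `X` is strongly `n`-homogeneous if every bijection between two `n`-element subsets of `X`
extends to a self-homeomorphism of `X`. -/
def IsStronglyHomogeneous (n : ℕ) (X : Type u) [TopologicalSpace X] : Prop :=
  ∀ A B : Finset X, A.card = n → B.card = n →
    ∀ e : A ≃ B, ∃ h : X ≃ₜ X, ∀ a : A, h (a : X) = (e a : X)

/-- `X` is countable dense homogeneous if any countable dense subset is mapped onto any other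
one by a self-homeomorphism of `X`. -/
def IsCountableDenseHomogeneous (X : Type u) [TopologicalSpace X] : Prop :=
  ∀ A B : Set X, A.Countable → Dense A → B.Countable → Dense B → ∃ h : X ≃ₜ X, h '' A = B

/-- The subset `R` of `E` is a retract of the subset `W`. -/
def IsRetractOf {E : Type u} [TopologicalSpace E] (R W : Set E) : Prop :=
  R ⊆ W ∧ ∃ r : E → E, ContinuousOn r W ∧ Set.MapsTo r W R ∧ ∀ x ∈ R, r x = x

/-- `X` is a Euclidean neighborhood retract if it is homeomorphic to a retract of an open subset
of `ℝⁿ` for some `n ≥ 1`. -/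
def IsEuclideanNhdRetract (X : Type u) [TopologicalSpace X] : Prop :=
  ∃ n : ℕ, 1 ≤ n ∧ ∃ W R : Set (EuclideanSpace ℝ (Fin n)),
    IsOpen W ∧ IsRetractOf R W ∧ Nonempty (X ≃ₜ R)

/-- `X` is a topological manifold (without boundary): Hausdorff, second countable, and for some
`n` covered by open sets that are homeomorphic to open subsets of `ℝⁿ`. -/
def IsTopologicalManifold (X : Type u) [TopologicalSpace X] : Prop :=
  T2Space X ∧ SecondCountableTopology X ∧
    ∃ n : ℕ, Nonempty (ChartedSpace (EuclideanSpace ℝ (Fin n)) X)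

/-! The core is strong local homogeneity: near each point, nearby points are interchanged by
homeomorphisms of small support. One cone chart suffices. Radial contractions, extended by the
identity, bring every point near the vertex arbitrarily close to it (`isLocallyAttracting_vertex`).
By homogeneity and a Baire category argument in the style of Effros, the reverse also holds: the
closures of the orbits under small supports are neighborhoods
(`IsHomogeneousSpace.nearlyMicrotransitive`). Completeness removes the word "closure": two nearby
points are moved alternately towards each other, and the two sequences of homeomorphisms converge
(`NearlyMicrotransitive.stronglyLocallyHomogeneous`).

Countable dense homogeneity follows by back-and-forth with small corrections.

Strong `n`-homogeneity follows by moving points one at a time, provided finite sets do not separate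
components. Off the vertex the cone is `Y × ℝ`. If `Y` had an isolated point, `X` would contain an
open line and be a 1-manifold by homogeneity. Otherwise points of `Y × ℝ` do not separate small
neighborhoods, and by homogeneity no point of `X` does
(`IsHomogeneousSpace.hasPreconnectedPuncturedNhds`). -/

open Set Filter Topology

/-! ### Homeomorphisms with prescribed support -/

section SupportedHomeomorphisms

variable {X : Type u} [TopologicalSpace X]

/-- The homeomorphism `h` is the identity outside `O`. -/
def IsSupportedIn (h : X ≃ₜ X) (O : Set X) : Prop := ∀ x, x ∉ O → h x = x

/-- The point `y` lies in the closure of the orbit of `x` under the homeomorphisms supported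
in `O`. -/
def NearlyReaches (O : Set X) (x y : X) : Prop :=
  ∀ N ∈ 𝓝 y, ∃ h : X ≃ₜ X, IsSupportedIn h O ∧ h x ∈ N

/-- Every point is moved into any prescribed small neighborhood of any nearby point by
homeomorphisms with small support. -/
def NearlyMicrotransitive (X : Type u) [TopologicalSpace X] : Prop :=
  ∀ x : X, ∀ O ∈ 𝓝 x, ∀ᶠ y in 𝓝 x, NearlyReaches O x y

/-- Every point is moved onto any nearby point by a homeomorphism with small support. -/
def StronglyLocallyHomogeneous (X : Type u) [TopologicalSpace X] : Prop :=
  ∀ x : X, ∀ O ∈ 𝓝 x, ∀ᶠ y in 𝓝 x, ∃ h : X ≃ₜ X, IsSupportedIn h O ∧ h x = y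

namespace IsSupportedIn

variable {h k : X ≃ₜ X} {O P : Set X}

theorem refl (O : Set X) : IsSupportedIn (Homeomorph.refl X) O := fun _ _ => rfl

theorem mono (hh : IsSupportedIn h O) (hOP : O ⊆ P) : IsSupportedIn h P :=
  fun x hx => hh x fun hxO => hx (hOP hxO)

theorem symm (hh : IsSupportedIn h O) : IsSupportedIn h.symm O := fun x hx => by
  conv_lhs => rw [← hh x hx]
  exact h.symm_apply_apply x

theorem trans (hh : IsSupportedIn h O) (hk : IsSupportedIn k O) : IsSupportedIn (h.trans k) O :=
  fun x hx => by rw [Homeomorph.trans_apply, hh x hx, hk x hx]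

theorem apply_mem (hh : IsSupportedIn h O) {x : X} (hx : x ∈ O) : h x ∈ O := by
  by_contra hn
  have := hh (h x) hn
  rw [h.injective this] at hn
  exact hn hx

theorem mem_iff (hh : IsSupportedIn h O) (x : X) : x ∈ O ↔ h x ∈ O :=
  ⟨hh.apply_mem, fun hx => by simpa using hh.symm.apply_mem hx⟩

theorem conj (hh : IsSupportedIn h O) (k : X ≃ₜ X) :
    IsSupportedIn ((k.symm.trans h).trans k) (k '' O) := fun x hx => by
  have : k.symm x ∉ O := fun hO => hx ⟨_, hO, k.apply_symm_apply x⟩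
  simp [hh _ this]

end IsSupportedIn

theorem NearlyReaches.mono {O P : Set X} {x y : X} (hxy : NearlyReaches O x y) (hOP : O ⊆ P) :
    NearlyReaches P x y := fun N hN =>
  let ⟨h, hh, hx⟩ := hxy N hN
  ⟨h, hh.mono hOP, hx⟩

theorem NearlyReaches.image {O : Set X} {x y : X} (hxy : NearlyReaches O x y) (k : X ≃ₜ X) :
    NearlyReaches (k '' O) (k x) (k y) := fun N hN => by
  obtain ⟨h, hh, hx⟩ := hxy (k ⁻¹' N) (k.continuous.continuousAt hN)
  exact ⟨_, hh.conj k, by simpa using hx⟩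

end SupportedHomeomorphisms

section Recursion

theorem exists_seq_of_step {α : Type*} (P : ℕ → α → Prop) (R : ℕ → α → α → Prop) {a : α}
    (ha : P 0 a) (step : ∀ n a, P n a → ∃ b, P (n + 1) b ∧ R n a b) :
    ∃ f : ℕ → α, f 0 = a ∧ ∀ n, P n (f n) ∧ R n (f n) (f (n + 1)) := by
  choose! g hg using step
  let f : ℕ → α := fun n => Nat.rec a (fun n b => g n b) n
  have hf : ∀ n, P n (f n) := fun n => by
    induction n with
    | zero => exact ha
    | succ n ih => exact (hg n _ ih).1
  exact ⟨f, rfl, fun n => ⟨hf n, (hg n _ (hf n)).2⟩⟩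

end Recursion

/-! ### Limits of fast converging homeomorphisms -/

section Limits

theorem tendsto_two_mul_half_pow :
    Tendsto (fun n : ℕ => 2 * (1 / 2 : ℝ) ^ n) atTop (𝓝 0) := by
  simpa using (tendsto_pow_atTop_nhds_zero_of_lt_one (by norm_num)
    (by norm_num : (1 / 2 : ℝ) < 1)).const_mul (2 : ℝ)

variable {X : Type u} [MetricSpace X]

/-- Two homeomorphisms and their inverses are uniformly `ε`-close. -/
def HomeoClose (ε : ℝ) (F G : X ≃ₜ X) : Prop :=
  (∀ x, dist (F x) (G x) ≤ ε) ∧ ∀ x, dist (F.symm x) (G.symm x) ≤ ε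

theorem HomeoClose.refl {ε : ℝ} (hε : 0 ≤ ε) (F : X ≃ₜ X) : HomeoClose ε F F := by
  simp [HomeoClose, hε]

theorem HomeoClose.trans {ε δ : ℝ} {F G H : X ≃ₜ X} (hFG : HomeoClose ε F G)
    (hGH : HomeoClose δ G H) : HomeoClose (ε + δ) F H :=
  ⟨fun x => (dist_triangle _ _ _).trans (add_le_add (hFG.1 x) (hGH.1 x)),
    fun x => (dist_triangle _ _ _).trans (add_le_add (hFG.2 x) (hGH.2 x))⟩

theorem exists_tendsto_of_dist_le_half_pow [CompleteSpace X] {f : ℕ → X → X}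
    (hc : ∀ n, Continuous (f n)) (hf : ∀ n x, dist (f n x) (f (n + 1) x) ≤ (1 / 2) ^ n) :
    ∃ g : X → X, Continuous g ∧ ∀ n x, dist (f n x) (g x) ≤ 2 * (1 / 2) ^ n := by
  have h2 : (1 / 2 : ℝ) < 1 := by norm_num
  have hf' : ∀ x n, dist (f n x) (f (n + 1) x) ≤ 1 * (1 / 2) ^ n := fun x n => by
    simpa using hf n x
  have hlim : ∀ x, ∃ y, Tendsto (fun n => f n x) atTop (𝓝 y) := fun x =>
    cauchySeq_tendsto_of_complete (cauchySeq_of_le_geometric (1 / 2) 1 h2 (hf' x))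
  choose g hg using hlim
  have hd : ∀ n x, dist (f n x) (g x) ≤ 2 * (1 / 2) ^ n := fun n x => by
    have := dist_le_of_le_geometric_of_tendsto (1 / 2) 1 h2 (hf' x) (hg x) n
    calc _ ≤ _ := this
      _ = _ := by ring
  refine ⟨g, ?_, hd⟩
  have hu : TendstoUniformly f g atTop := by
    rw [Metric.tendstoUniformly_iff]
    intro ε hε
    filter_upwards [tendsto_two_mul_half_pow.eventually (gt_mem_nhds hε)] with n hn x
    rw [dist_comm]
    exact (hd n x).trans_lt hn
  exact hu.continuous (Frequently.of_forall hc)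

/-- Uniform convergence allows a moving argument. With `u n = F n x` this shows that the limit of
the maps and the limit of their inverses are mutually inverse. -/
theorem tendsto_apply_of_dist_le {f : ℕ → X → X} {g : X → X} (hg : Continuous g)
    (hd : ∀ n x, dist (f n x) (g x) ≤ 2 * (1 / 2) ^ n) {u : ℕ → X} {x : X}
    (hu : Tendsto u atTop (𝓝 x)) : Tendsto (fun n => f n (u n)) atTop (𝓝 (g x)) := by
  have h1 : Tendsto (fun n => g (u n)) atTop (𝓝 (g x)) := (hg.tendsto x).comp hu
  refine (tendsto_iff_of_dist ?_).2 h1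
  exact squeeze_zero (fun _ => dist_nonneg) (fun n => hd n (u n)) tendsto_two_mul_half_pow

/-- A sequence of homeomorphisms of a complete metric space that converges fast, together with
the inverses, has a homeomorphism as its limit. -/
theorem exists_homeomorph_tendsto [CompleteSpace X] {F : ℕ → X ≃ₜ X}
    (hF : ∀ n, HomeoClose ((1 / 2) ^ n) (F n) (F (n + 1))) :
    ∃ H : X ≃ₜ X, ∀ x, Tendsto (fun n => F n x) atTop (𝓝 (H x)) := by
  obtain ⟨g, hgc, hg⟩ := exists_tendsto_of_dist_le_half_pow (f := fun n => F n)
    (fun n => (F n).continuous) fun n => (hF n).1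
  obtain ⟨k, hkc, hk⟩ := exists_tendsto_of_dist_le_half_pow (f := fun n => (F n).symm)
    (fun n => (F n).symm.continuous) fun n => (hF n).2
  have hgt : ∀ x, Tendsto (fun n => F n x) atTop (𝓝 (g x)) := fun x =>
    tendsto_apply_of_dist_le hgc hg tendsto_const_nhds
  have hkt : ∀ x, Tendsto (fun n => (F n).symm x) atTop (𝓝 (k x)) := fun x =>
    tendsto_apply_of_dist_le hkc hk tendsto_const_nhds
  have hkg : ∀ x, k (g x) = x := fun x => by
    have := tendsto_apply_of_dist_le hkc hk (hgt x)
    simp only [Homeomorph.symm_apply_apply] at this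
    exact tendsto_nhds_unique this tendsto_const_nhds
  have hgk : ∀ x, g (k x) = x := fun x => by
    have := tendsto_apply_of_dist_le hgc hg (hkt x)
    simp only [Homeomorph.apply_symm_apply] at this
    exact tendsto_nhds_unique this tendsto_const_nhds
  exact ⟨⟨⟨g, k, hkg, hgk⟩, hgc, hkc⟩, hgt⟩

/-- Composing `F` with a homeomorphism whose support is small near `z` changes `F` and its inverse
only slightly. -/
theorem exists_nhds_homeoClose_trans (F : X ≃ₜ X) (z : X) {ε : ℝ} (hε : 0 < ε) :
    ∃ O ∈ 𝓝 z, ∀ h : X ≃ₜ X, IsSupportedIn h O → HomeoClose ε F (F.trans h) := by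
  -- The first ball controls the change of `F`, the second the change of its inverse.
  refine ⟨Metric.ball z (ε / 2) ∩ F.symm ⁻¹' Metric.ball (F.symm z) (ε / 2),
    inter_mem (Metric.ball_mem_nhds _ (half_pos hε))
      (F.symm.continuous.continuousAt (Metric.ball_mem_nhds _ (half_pos hε))), ?_⟩
  intro h hh
  constructor
  · intro x
    by_cases hx : F x ∈ Metric.ball z (ε / 2) ∩ F.symm ⁻¹' Metric.ball (F.symm z) (ε / 2)
    · have h1 := hx.1
      have h2 := (hh.apply_mem hx).1
      rw [Metric.mem_ball] at h1 h2
      have := dist_triangle_right (F x) (h (F x)) z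
      rw [Homeomorph.trans_apply]
      linarith
    · rw [Homeomorph.trans_apply, hh _ hx, dist_self]
      exact hε.le
  · intro x
    rw [Homeomorph.symm_trans_apply]
    by_cases hx : x ∈ Metric.ball z (ε / 2) ∩ F.symm ⁻¹' Metric.ball (F.symm z) (ε / 2)
    · have h1 := hx.2
      have h2 := (hh.symm.apply_mem hx).2
      rw [mem_preimage, Metric.mem_ball] at h1 h2
      have := dist_triangle_right (F.symm x) (F.symm (h.symm x)) (F.symm z)
      linarith
    · rw [hh.symm _ hx, dist_self]
      exact hε.le

end Limits

/-! ### From orbit closures to orbits -/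

section MicrotransitiveOfNearly

variable {X : Type u} [MetricSpace X]

theorem NearlyMicrotransitive.exists_nhds (hM : NearlyMicrotransitive X) {O₀ : Set X}
    (F : X ≃ₜ X) (z : X) (hO₀ : O₀ ∈ 𝓝 z) {ε : ℝ} (hε : 0 < ε) :
    ∃ O ⊆ O₀, (∀ h : X ≃ₜ X, IsSupportedIn h O → HomeoClose ε F (F.trans h)) ∧
      ∀ᶠ y in 𝓝 z, NearlyReaches O z y := by
  obtain ⟨O, hO, hF⟩ := exists_nhds_homeoClose_trans F z hε
  exact ⟨O ∩ O₀, inter_subset_right, fun h hh => hF h (hh.mono inter_subset_left),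
    hM z _ (inter_mem hO hO₀)⟩

/-- Moving `F x` close to `G y` in such a way that afterwards `G y` can be moved
close to the new `F x`, by a small change of `G`. -/
theorem NearlyMicrotransitive.approach (hM : NearlyMicrotransitive X) {O₀ : Set X}
    (hO₀ : IsOpen O₀) {F G : X ≃ₜ X} {x y : X} (hy : y ∈ O₀)
    (hF : IsSupportedIn F O₀) (hG : IsSupportedIn G O₀) {ε δ : ℝ} (hδ : 0 < δ)
    (hFG : ∃ O ⊆ O₀, (∀ h : X ≃ₜ X, IsSupportedIn h O → HomeoClose ε F (F.trans h)) ∧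
      NearlyReaches O (F x) (G y)) :
    ∃ F' : X ≃ₜ X, IsSupportedIn F' O₀ ∧ HomeoClose ε F F' ∧ dist (F' x) (G y) < δ ∧
      ∃ O ⊆ O₀, (∀ h : X ≃ₜ X, IsSupportedIn h O → HomeoClose δ G (G.trans h)) ∧
        NearlyReaches O (G y) (F' x) := by
  obtain ⟨O, hOO₀, hclose, hreach⟩ := hFG
  obtain ⟨P, hPO₀, hPclose, hP⟩ := hM.exists_nhds G (G y) (hO₀.mem_nhds (hG.apply_mem hy)) hδ
  -- The target of the move is chosen among the points that `G y` nearly reaches inside `P`; this is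
  -- what lets the two sides swap roles.
  obtain ⟨h, hh, hhx⟩ := hreach _ (inter_mem hP (Metric.ball_mem_nhds (G y) hδ))
  exact ⟨F.trans h, hF.trans (hh.mono hOO₀), hclose h hh, hhx.2, P, hPO₀, hPclose, hhx.1⟩

/-- In a complete metric space, nearly microtransitive actions of the homeomorphisms with small
support are microtransitive. -/
theorem NearlyMicrotransitive.stronglyLocallyHomogeneous [CompleteSpace X]
    (hM : NearlyMicrotransitive X) : StronglyLocallyHomogeneous X := by
  intro x O₁ hO₁
  obtain ⟨O₀, hO₀₁, hO₀, hx⟩ := mem_nhds_iff.1 hO₁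
  obtain ⟨O, hOO₀, hclose, hO⟩ :=
    hM.exists_nhds (Homeomorph.refl X) x (hO₀.mem_nhds hx) (ε := (1 / 2) ^ 0) (by norm_num)
  filter_upwards [hO, hO₀.mem_nhds hx] with y hxy hy
  obtain ⟨f, -, hf⟩ := exists_seq_of_step
    (fun n (p : (X ≃ₜ X) × (X ≃ₜ X)) => IsSupportedIn p.1 O₀ ∧ IsSupportedIn p.2 O₀ ∧
      ∃ O ⊆ O₀, (∀ h : X ≃ₜ X, IsSupportedIn h O →
        HomeoClose ((1 / 2) ^ n) p.1 (p.1.trans h)) ∧ NearlyReaches O (p.1 x) (p.2 y))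
    (fun n p q => HomeoClose ((1 / 2) ^ n) p.1 q.1 ∧ HomeoClose ((1 / 2) ^ n) p.2 q.2 ∧
      dist (q.1 x) (q.2 y) ≤ 2 * (1 / 2) ^ n)
    (a := (Homeomorph.refl X, Homeomorph.refl X))
    ⟨IsSupportedIn.refl _, IsSupportedIn.refl _, O, hOO₀, hclose, hxy⟩ (by
      rintro n ⟨F, G⟩ ⟨hF, hG, hFG⟩
      have hn : (0 : ℝ) < (1 / 2) ^ n := by positivity
      obtain ⟨F', hF', hFF', -, hGF'⟩ := hM.approach hO₀ hy hF hG hn hFG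
      obtain ⟨G', hG', hGG', hd, hFG'⟩ :=
        -- Same step with the roles of `F` and `G` exchanged. The exponent `n + 1` is the allowance
        -- for the next change of `F'`.
        hM.approach hO₀ hx hG hF' (by positivity : (0 : ℝ) < (1 / 2) ^ (n + 1)) hGF'
      refine ⟨(F', G'), ⟨hF', hG', hFG'⟩, hFF', hGG', ?_⟩
      rw [dist_comm]
      rw [pow_succ] at hd
      linarith)
  obtain ⟨H, hH⟩ := exists_homeomorph_tendsto fun n => (hf n).2.1
  obtain ⟨K, hK⟩ := exists_homeomorph_tendsto fun n => (hf n).2.2.1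
  have hHK : H x = K y := by
    have h0 : Tendsto (fun n => dist ((f (n + 1)).1 x) ((f (n + 1)).2 y)) atTop (𝓝 0) :=
      squeeze_zero (fun _ => dist_nonneg) (fun n => (hf n).2.2.2) tendsto_two_mul_half_pow
    have h1 := ((hH x).dist (hK y)).comp (tendsto_add_atTop_nat 1)
    exact dist_eq_zero.1 (tendsto_nhds_unique h1 h0)
  have hHs : IsSupportedIn H O₀ := fun z hz =>
    tendsto_nhds_unique (hH z) (by simp [(hf _).1.1 z hz])
  have hKs : IsSupportedIn K O₀ := fun z hz =>
    tendsto_nhds_unique (hK z) (by simp [(hf _).1.2.1 z hz])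
  exact ⟨H.trans K.symm, (hHs.trans hKs.symm).mono hO₀₁, by simp [hHK]⟩

end MicrotransitiveOfNearly

/-! ### Countable dense homogeneity by back-and-forth -/

section CountableDense

variable {X : Type u} [MetricSpace X]

/-- The finite set `S` collects the values already settled. The support of the correction avoids
`S`, so they stay fixed. -/
theorem StronglyLocallyHomogeneous.exists_apply_mem (hS : StronglyLocallyHomogeneous X)
    {B : Set X} (hB : Dense B) (F : X ≃ₜ X) {S : Set X} (hSf : S.Finite) (hSB : S ⊆ B)
    {ε : ℝ} (hε : 0 < ε) (a : X) :
    ∃ F' : X ≃ₜ X, HomeoClose ε F F' ∧ (∀ x, F x ∈ S → F' x = F x) ∧ F' a ∈ B := by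
  by_cases ha : F a ∈ S
  · exact ⟨F, HomeoClose.refl hε.le F, fun _ _ => rfl, hSB ha⟩
  obtain ⟨O, hO, hclose⟩ := exists_nhds_homeoClose_trans F (F a) hε
  have hev := hS (F a) _ (inter_mem hO (hSf.isClosed.isOpen_compl.mem_nhds ha))
  obtain ⟨b, hbB, h, hh, hb⟩ := (mem_closure_iff_frequently.1 (hB (F a))).and_eventually hev |>.exists
  refine ⟨F.trans h, hclose h (hh.mono inter_subset_left), fun x hx => ?_, ?_⟩
  · exact hh _ fun hx' => hx'.2 hx
  · rwa [Homeomorph.trans_apply, hb]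

theorem StronglyLocallyHomogeneous.exists_mem_image (hS : StronglyLocallyHomogeneous X)
    {A : Set X} (hA : Dense A) (F : X ≃ₜ X) {S : Set X} (hSf : S.Finite) (hSA : S ⊆ F '' A)
    {ε : ℝ} (hε : 0 < ε) (b : X) :
    ∃ F' : X ≃ₜ X, HomeoClose ε F F' ∧ (∀ x, F x ∈ S → F' x = F x) ∧ b ∈ F' '' A := by
  by_cases hb : b ∈ S
  · exact ⟨F, HomeoClose.refl hε.le F, fun _ _ => rfl, hSA hb⟩
  obtain ⟨O, hO, hclose⟩ := exists_nhds_homeoClose_trans F b hε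
  have hev := hS b _ (inter_mem hO (hSf.isClosed.isOpen_compl.mem_nhds hb))
  have hFA : Dense (F '' A) := F.surjective.denseRange.dense_image F.continuous hA
  obtain ⟨_, ⟨a, ha, rfl⟩, h, hh, hba⟩ :=
    (mem_closure_iff_frequently.1 (hFA b)).and_eventually hev |>.exists
  refine ⟨F.trans h.symm, hclose _ (hh.symm.mono inter_subset_left), fun x hx => ?_, a, ha, ?_⟩
  · exact hh.symm _ fun hx' => hx'.2 hx
  · simp [← hba]

theorem StronglyLocallyHomogeneous.back_and_forth_step (hS : StronglyLocallyHomogeneous X)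
    {A B : Set X} (hA : Dense A) (hB : Dense B) {a b : X} (ha : a ∈ A) (hb : b ∈ B)
    {F : X ≃ₜ X} {S : Set X} (hSf : S.Finite) (hSB : S ⊆ B) (hSA : S ⊆ F '' A)
    {ε : ℝ} (hε : 0 < ε) :
    ∃ (F' : X ≃ₜ X) (S' : Set X), S'.Finite ∧ S' ⊆ B ∧ S' ⊆ F' '' A ∧ HomeoClose ε F F' ∧
      S ⊆ S' ∧ (∀ x, F x ∈ S → F' x = F x) ∧ F' a ∈ S' ∧ b ∈ S' := by
  obtain ⟨F₁, hF₁, hF₁S, hF₁a⟩ := hS.exists_apply_mem hB F hSf hSB (half_pos hε) a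
  have hS₁A : insert (F₁ a) S ⊆ F₁ '' A := by
    rintro s (rfl | hs)
    · exact ⟨a, ha, rfl⟩
    · obtain ⟨c, hc, rfl⟩ := hSA hs
      exact ⟨c, hc, hF₁S c hs⟩
  obtain ⟨F₂, hF₂, hF₂S, hF₂b⟩ :=
    hS.exists_mem_image hA F₁ (hSf.insert (F₁ a)) hS₁A (half_pos hε) b
  have hF₂a : F₂ a = F₁ a := hF₂S a (mem_insert _ _)
  refine ⟨F₂, insert b (insert (F₁ a) S), (hSf.insert _).insert _, ?_, ?_, ?_, ?_, ?_, ?_, ?_⟩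
  · rintro s (rfl | rfl | hs)
    exacts [hb, hF₁a, hSB hs]
  · rintro s (rfl | hs)
    · exact hF₂b
    · obtain ⟨c, hc, rfl⟩ := hS₁A hs
      exact ⟨c, hc, hF₂S c hs⟩
  · simpa using hF₁.trans hF₂
  · exact fun s hs => mem_insert_of_mem _ (mem_insert_of_mem _ hs)
  · intro x hx
    have h1 := hF₁S x hx
    rw [hF₂S x (mem_insert_of_mem _ (h1 ▸ hx)), h1]
  · exact mem_insert_of_mem _ (hF₂a ▸ mem_insert _ _)
  · exact mem_insert _ _

theorem StronglyLocallyHomogeneous.isCountableDenseHomogeneous [CompleteSpace X]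
    (hS : StronglyLocallyHomogeneous X) : IsCountableDenseHomogeneous X := by
  intro A B hAc hA hBc hB
  rcases isEmpty_or_nonempty X with hX | hX
  · exact ⟨Homeomorph.refl X, Subsingleton.elim _ _⟩
  obtain ⟨a, rfl⟩ := hAc.exists_eq_range hA.nonempty
  obtain ⟨b, rfl⟩ := hBc.exists_eq_range hB.nonempty
  obtain ⟨f, -, hf⟩ := exists_seq_of_step
    (fun _ (p : (X ≃ₜ X) × Set X) => p.2.Finite ∧ p.2 ⊆ range b ∧ p.2 ⊆ p.1 '' range a)
    (fun n p q => HomeoClose ((1 / 2) ^ n) p.1 q.1 ∧ p.2 ⊆ q.2 ∧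
      (∀ x, p.1 x ∈ p.2 → q.1 x = p.1 x) ∧ q.1 (a n) ∈ q.2 ∧ b n ∈ q.2)
    (a := (Homeomorph.refl X, ∅)) (by simp) (by
      rintro n ⟨F, S⟩ ⟨hSf, hSB, hSA⟩
      obtain ⟨F', S', h1, h2, h3, h4⟩ := hS.back_and_forth_step hA hB (mem_range_self n)
        (mem_range_self n) hSf hSB hSA (by positivity : (0 : ℝ) < (1 / 2) ^ n)
      exact ⟨(F', S'), ⟨h1, h2, h3⟩, h4⟩)
  obtain ⟨H, hH⟩ := exists_homeomorph_tendsto fun n => (hf n).2.1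
  -- Once a value enters the settled set it never changes again, hence equals the limit value.
  have hstable : ∀ n x, (f n).1 x ∈ (f n).2 → H x = (f n).1 x := by
    intro n x hx
    have hk : ∀ k, (f (n + k)).1 x = (f n).1 x ∧ (f (n + k)).1 x ∈ (f (n + k)).2 := by
      intro k
      induction k with
      | zero => exact ⟨rfl, hx⟩
      | succ k ih =>
        have h1 := (hf (n + k)).2.2.2.1 x ih.2
        have h2 := (hf (n + k)).2.2.1 ih.2
        rw [← add_assoc, h1]
        exact ⟨ih.1, h2⟩
    refine tendsto_nhds_unique (hH x) (tendsto_const_nhds.congr' ?_)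
    filter_upwards [eventually_ge_atTop n] with m hm
    obtain ⟨k, rfl⟩ := Nat.exists_eq_add_of_le hm
    exact (hk k).1.symm
  refine ⟨H, Subset.antisymm ?_ ?_⟩
  · rintro _ ⟨_, ⟨n, rfl⟩, rfl⟩
    have := (hf n).2.2.2.2.1
    rw [hstable _ _ this]
    exact (hf (n + 1)).1.2.1 this
  · rintro _ ⟨n, rfl⟩
    have hbn := (hf n).2.2.2.2.2
    obtain ⟨x, hx, hxb⟩ := (hf (n + 1)).1.2.2 hbn
    refine ⟨x, hx, ?_⟩
    rw [← hxb] at hbn ⊢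
    exact hstable _ _ hbn

end CountableDense

/-! ### Strong homogeneity and non-separation by finite sets -/

section StrongHomogeneity

variable {X : Type u} [TopologicalSpace X]

/-- Inside `D`, the orbits of the homeomorphisms supported in `D` are open, so a preconnected `D`
contains at most one. -/
theorem StronglyLocallyHomogeneous.exists_apply_eq (hS : StronglyLocallyHomogeneous X) {D : Set X}
    (hD : IsOpen D) (hDc : IsPreconnected D) {x y : X} (hx : x ∈ D) (hy : y ∈ D) :
    ∃ h : X ≃ₜ X, IsSupportedIn h D ∧ h x = y := by
  refine hDc.induction₂ (fun x y => ∃ h : X ≃ₜ X, IsSupportedIn h D ∧ h x = y) ?_ ?_ ?_ hx hy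
  · exact fun x hx => mem_nhdsWithin_of_mem_nhds (hS x D (hD.mem_nhds hx))
  · rintro x y z - - - ⟨h, hh, rfl⟩ ⟨k, hk, rfl⟩
    exact ⟨h.trans k, hh.trans hk, rfl⟩
  · rintro x y - - ⟨h, hh, rfl⟩
    exact ⟨h.symm, hh.symm, by simp⟩

theorem StronglyLocallyHomogeneous.exists_extension [T1Space X]
    (hS : StronglyLocallyHomogeneous X) {C : Set X} (hC : IsOpen C)
    (hCc : ∀ S : Set X, S.Finite → IsPreconnected (C \ S)) {f : X → X} (A : Finset X) :
    (∀ a ∈ A, a ∈ C) → (∀ a ∈ A, f a ∈ C) → InjOn f A →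
      ∃ h : X ≃ₜ X, IsSupportedIn h C ∧ ∀ a ∈ A, h a = f a := by
  classical
  induction A using Finset.induction_on with
  | empty => exact fun _ _ _ => ⟨Homeomorph.refl X, IsSupportedIn.refl C, by simp⟩
  | insert a A haA ih =>
    intro hAC hfC hf
    obtain ⟨h, hh, hhf⟩ := ih (fun b hb => hAC b (Finset.mem_insert_of_mem hb))
      (fun b hb => hfC b (Finset.mem_insert_of_mem hb)) (hf.mono (by simp))
    have haC : h a ∈ C \ f '' A := by
      refine ⟨hh.apply_mem (hAC a (Finset.mem_insert_self _ _)), ?_⟩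
      rintro ⟨b, hb, hba⟩
      rw [← hhf b hb] at hba
      exact haA (h.injective hba ▸ hb)
    have hfa : f a ∈ C \ f '' A := by
      refine ⟨hfC a (Finset.mem_insert_self _ _), ?_⟩
      rintro ⟨b, hb, hba⟩
      exact haA (hf (by simpa using Or.inr hb) (by simp) hba ▸ hb)
    have hfin : (f '' (A : Set X)).Finite := A.finite_toSet.image f
    -- The last point is moved within `C \ f '' A`, so the values already attained on `A` are not
    -- disturbed.
    obtain ⟨k, hk, hka⟩ := hS.exists_apply_eq (hC.sdiff hfin.isClosed) (hCc _ hfin) haC hfa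
    refine ⟨h.trans k, hh.trans (hk.mono sdiff_subset), fun b hb => ?_⟩
    rcases Finset.mem_insert.1 hb with rfl | hb
    · exact hka
    · rw [Homeomorph.trans_apply, hhf b hb]
      exact hk _ fun hmem => hmem.2 ⟨b, hb, rfl⟩

theorem StronglyLocallyHomogeneous.isStronglyHomogeneous [T1Space X]
    (hS : StronglyLocallyHomogeneous X) {C : Set X} (hC : IsOpen C)
    (hCc : ∀ S : Set X, S.Finite → IsPreconnected (C \ S)) (n : ℕ) :
    IsStronglyHomogeneous n C := by
  classical
  intro A B _ _ e
  let f : X → X := fun x => if hx : ∃ hxC : x ∈ C, (⟨x, hxC⟩ : C) ∈ A then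
    ((e ⟨⟨x, hx.1⟩, hx.2⟩ : C) : X) else x
  have hf : ∀ a : A, f ((a : C) : X) = ((e a : C) : X) := fun a => by
    have : ∃ hxC : ((a : C) : X) ∈ C, (⟨((a : C) : X), hxC⟩ : C) ∈ A := ⟨a.1.2, a.2⟩
    simp only [f, dif_pos this]
  obtain ⟨h, hh, hhf⟩ := hS.exists_extension hC hCc (f := f) (A.image Subtype.val)
    (by simp +contextual) (by
      intro a ha
      obtain ⟨c, hc, rfl⟩ := Finset.mem_image.1 ha
      rw [hf ⟨c, hc⟩]
      exact Subtype.coe_prop _) (by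
      intro a ha b hb hab
      obtain ⟨c, hc, rfl⟩ := Finset.mem_image.1 (Finset.mem_coe.1 ha)
      obtain ⟨d, hd, rfl⟩ := Finset.mem_image.1 (Finset.mem_coe.1 hb)
      rw [hf ⟨c, hc⟩, hf ⟨d, hd⟩] at hab
      have := e.injective (Subtype.ext (Subtype.ext hab))
      rw [Subtype.mk.injEq] at this
      rw [this])
  refine ⟨h.subtype hh.mem_iff, fun a => Subtype.ext ?_⟩
  rw [← hf a]
  exact hhf _ (Finset.mem_image_of_mem _ a.2)

/-- The deletion of a point does not disconnect small neighborhoods of that point. -/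
def HasPreconnectedPuncturedNhds {X : Type*} [TopologicalSpace X] (x : X) : Prop :=
  ∀ O ∈ 𝓝 x, ∃ V ∈ 𝓝 x, V ⊆ O ∧ IsPreconnected (V \ {x})

theorem HasPreconnectedPuncturedNhds.map {Z : Type*} [TopologicalSpace Z] {x : X}
    (hx : HasPreconnectedPuncturedNhds x) {f : X → Z} (hf : IsOpenEmbedding f) :
    HasPreconnectedPuncturedNhds (f x) := fun O hO => by
  obtain ⟨V, hV, hVO, hVc⟩ := hx (f ⁻¹' O) (hf.continuous.continuousAt hO)
  refine ⟨f '' V, hf.isOpenMap.image_mem_nhds hV, image_subset_iff.2 hVO, ?_⟩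
  rw [← image_singleton, ← image_sdiff hf.injective]
  exact hVc.image _ hf.continuous.continuousOn

theorem HasPreconnectedPuncturedNhds.isPreconnected_diff [T1Space X] {x : X}
    (hx : HasPreconnectedPuncturedNhds x) {C : Set X} (hC : IsOpen C) (hCc : IsPreconnected C) :
    IsPreconnected (C \ {x}) := by
  by_cases hxC : x ∈ C
  swap
  · rwa [sdiff_singleton_eq_self hxC]
  obtain ⟨V, hV, hVC, hVc⟩ := hx C (hC.mem_nhds hxC)
  have hopen : IsOpen (C \ {x}) := hC.sdiff isClosed_singleton
  -- In a separation of `C \ {x}`, the set `V \ {x}` lies on one side; adding `x` to that side would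
  -- separate `C`.
  have key : ∀ u v : Set X, IsOpen u → IsOpen v → C \ {x} ⊆ u ∪ v → C \ {x} ∩ (u ∩ v) = ∅ →
      V \ {x} ⊆ u → C \ {x} ⊆ u := by
    intro u v hu hv huv hdisj hVu
    have hcover : C ⊆ (u ∩ (C \ {x}) ∪ interior V) ∪ (v ∩ (C \ {x})) := by
      intro y hy
      by_cases hyx : y = x
      · rw [hyx]
        exact Or.inl (Or.inr (mem_interior_iff_mem_nhds.2 hV))
      · rcases huv ⟨hy, hyx⟩ with h | h
        · exact Or.inl (Or.inl ⟨h, hy, hyx⟩)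
        · exact Or.inr ⟨h, hy, hyx⟩
    have hd : C ∩ ((u ∩ (C \ {x}) ∪ interior V) ∩ (v ∩ (C \ {x}))) = ∅ := by
      rw [eq_empty_iff_forall_notMem] at hdisj ⊢
      rintro y ⟨hy, hy1 | hy1, hy2⟩
      · exact hdisj y ⟨hy1.2, hy1.1, hy2.1⟩
      · exact hdisj y ⟨hy2.2, hVu ⟨interior_subset hy1, hy2.2.2⟩, hy2.1⟩
    rcases isPreconnected_iff_subset_of_disjoint.1 hCc _ _
      ((hu.inter hopen).union isOpen_interior) (hv.inter hopen) hcover hd with h | h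
    · intro y hy
      rcases h hy.1 with h | h
      · exact h.1
      · exact hVu ⟨interior_subset h, hy.2⟩
    · exact absurd rfl (h hxC).2.2
  refine isPreconnected_iff_subset_of_disjoint.2 fun u v hu hv huv hdisj => ?_
  have hVC' : V \ {x} ⊆ C \ {x} := sdiff_subset_sdiff_left hVC
  rcases isPreconnected_iff_subset_of_disjoint.1 hVc u v hu hv (hVC'.trans huv)
    (subset_empty_iff.1 (hdisj ▸ inter_subset_inter_left _ hVC')) with h | h
  · exact Or.inl (key u v hu hv huv hdisj h)
  · exact Or.inr (key v u hv hu (union_comm u v ▸ huv) (inter_comm u v ▸ hdisj) h)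

theorem isPreconnected_diff_of_finite [T1Space X] (hX : ∀ x : X, HasPreconnectedPuncturedNhds x)
    {C : Set X} (hC : IsOpen C) (hCc : IsPreconnected C) (S : Set X) (hS : S.Finite) :
    IsPreconnected (C \ S) := by
  induction S, hS using Set.Finite.induction_on with
  | empty => simpa using hCc
  | @insert a S _ hS ih =>
    rw [← union_singleton, ← sdiff_sdiff]
    exact (hX a).isPreconnected_diff (hC.sdiff hS.isClosed) ih

end StrongHomogeneity

/-! ### The Baire category argument -/

section Baire

variable {X : Type u} [TopologicalSpace X]

/-- Every point near `x` is moved arbitrarily close to `x` by homeomorphisms supported in a given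
neighborhood. -/
def IsLocallyAttracting (x : X) : Prop :=
  ∀ O ∈ 𝓝 x, ∃ B ∈ 𝓝 x, B ⊆ O ∧ IsOpen B ∧ ∀ y ∈ B, NearlyReaches B y x

theorem IsHomogeneousSpace.eventually_nearlyReaches [T2Space X] [LocallyCompactSpace X]
    [SecondCountableTopology X] (hhom : IsHomogeneousSpace X) {p : X} (hp : IsLocallyAttracting p)
    {O : Set X} (hO : IsOpen O) (hpO : p ∈ O) : ∀ᶠ y in 𝓝 p, NearlyReaches O p y := by
  -- The choice of `h q` need not be continuous in `q`. Countably many basic conditions on the pair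
  -- `(h q, (h q)⁻¹)`, built from `K₁ ⊆ B ⊆ K₂ ⊆ interior K₃` and `K₃ ⊆ O`, replace continuity.
  choose h hh using hhom p
  obtain ⟨K₃, hK₃, hpK₃, hK₃O⟩ := exists_compact_between isCompact_singleton hO
    (singleton_subset_iff.2 hpO)
  obtain ⟨K₂, hK₂, hpK₂, hK₂₃⟩ := exists_compact_between isCompact_singleton isOpen_interior hpK₃
  obtain ⟨B, hpB, hBK₂, hB, hreach⟩ :=
    hp K₂ (mem_interior_iff_mem_nhds.1 (singleton_subset_iff.1 hpK₂))
  obtain ⟨K₁, hK₁, hpK₁, hK₁B⟩ := exists_compact_between isCompact_singleton hB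
    (singleton_subset_iff.2 (mem_of_mem_nhds hpB))
  rw [singleton_subset_iff] at hpK₁ hpK₂ hpK₃
  let Φ : X → C(X, X) × C(X, X) := fun q => ((h q : C(X, X)), ((h q).symm : C(X, X)))
  let N : X → Set (C(X, X) × C(X, X)) := fun i =>
    ({f : C(X, X) | MapsTo f {p} (h i '' interior K₁)} ∩ {f : C(X, X) | MapsTo f K₂ (h i '' interior K₃)}) ×ˢ
      ({g : C(X, X) | MapsTo g (h i '' K₁) B} ∩ {g : C(X, X) | MapsTo g (h i '' K₃) O})
  have hNo : ∀ i, IsOpen (N i) := fun i => by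
    have h1 : IsOpen (h i '' interior K₁) := (h i).isOpenMap _ isOpen_interior
    have h3 : IsOpen (h i '' interior K₃) := (h i).isOpenMap _ isOpen_interior
    exact ((ContinuousMap.isOpen_setOfPred_mapsTo isCompact_singleton h1).inter
      (ContinuousMap.isOpen_setOfPred_mapsTo hK₂ h3)).prod
      ((ContinuousMap.isOpen_setOfPred_mapsTo (hK₁.image (h i).continuous) hB).inter
      (ContinuousMap.isOpen_setOfPred_mapsTo (hK₃.image (h i).continuous) hO))
  have hNself : ∀ i, Φ i ∈ N i := fun i => by
    refine ⟨⟨?_, ?_⟩, ?_, ?_⟩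
    · rintro _ rfl
      exact mem_image_of_mem _ hpK₁
    · exact fun x hx => mem_image_of_mem _ (hK₂₃ hx)
    · rintro _ ⟨x, hx, rfl⟩
      simpa [Φ] using hK₁B hx
    · rintro _ ⟨x, hx, rfl⟩
      simpa [Φ] using hK₃O hx
  -- Second countability of the compact-open topology yields the countable subcover.
  obtain ⟨T, hT, hTU⟩ := TopologicalSpace.isOpen_iUnion_countable N hNo
  let S : X → Set X := fun i => Φ ⁻¹' N i
  have hcover : ⋃ i : T, closure (S i) = univ := by
    refine eq_univ_of_forall fun q => ?_
    have : Φ q ∈ ⋃ i ∈ T, N i := hTU ▸ mem_iUnion_of_mem q (hNself q)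
    simp only [mem_iUnion] at this
    obtain ⟨i, hi, hq⟩ := this
    exact mem_iUnion_of_mem ⟨i, hi⟩ (subset_closure hq)
  have : Countable T := hT.to_subtype
  have : Nonempty X := ⟨p⟩
  obtain ⟨⟨i, _⟩, z, hz⟩ := nonempty_interior_of_iUnion_of_closed (fun _ => isClosed_closure) hcover
  obtain ⟨q₀, hq₀i, hq₀⟩ := mem_closure_iff.1 (interior_subset hz) _ isOpen_interior hz
  -- For `q` and `q₀` in the same piece, `(h q)⁻¹ q₀` lies in `B`, hence is attracted to `p`.
  -- Conjugation by `h q` turns this into an attraction of `q₀` to `q`, with support in `h q '' B ⊆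
  -- h q₀ '' O`.
  have key : ∀ q ∈ S i, NearlyReaches (h q₀ '' O) q₀ q := by
    intro q hq
    obtain ⟨⟨-, hq2⟩, hq3, -⟩ := hq
    obtain ⟨⟨hq₀1, -⟩, -, hq₀4⟩ := hq₀
    have hB1 : (h q).symm q₀ ∈ B := by
      have h1 := hq₀1 (mem_singleton p)
      have h2 : (Φ q₀).1 p = q₀ := hh q₀
      rw [h2] at h1
      exact hq3 (image_mono interior_subset h1)
    have hsub : h q '' B ⊆ h q₀ '' O := by
      rintro _ ⟨x, hx, rfl⟩
      refine ⟨(h q₀).symm (h q x), hq₀4 (image_mono interior_subset (hq2 (hBK₂ hx))), ?_⟩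
      exact (h q₀).apply_symm_apply _
    have := (hreach _ hB1).image (h q)
    rw [(h q).apply_symm_apply, hh q] at this
    exact this.mono hsub
  -- The set of nearly reached points is closed, so density of the piece near `q₀` is enough.
  have hev : ∀ᶠ q in 𝓝 q₀, NearlyReaches (h q₀ '' O) q₀ q := by
    filter_upwards [isOpen_interior.mem_nhds hq₀i] with q hq M hM
    obtain ⟨q', hq'M, hq'⟩ := mem_closure_iff.1 (interior_subset hq) _ isOpen_interior
      (mem_interior_iff_mem_nhds.2 hM)
    exact key q' hq' M (mem_interior_iff_mem_nhds.1 hq'M)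
  have hcont := (h q₀).continuous.tendsto p
  rw [hh q₀] at hcont
  filter_upwards [hcont.eventually hev] with y hy
  have hsymm : (h q₀).symm q₀ = p := by
    rw [Homeomorph.symm_apply_eq, hh q₀]
  have := hy.image (h q₀).symm
  rwa [hsymm, Homeomorph.symm_apply_apply, ← image_comp, Homeomorph.symm_comp_self,
    image_id] at this

theorem IsHomogeneousSpace.nearlyMicrotransitive [T2Space X] [LocallyCompactSpace X]
    [SecondCountableTopology X] (hhom : IsHomogeneousSpace X) {p : X}
    (hp : IsLocallyAttracting p) : NearlyMicrotransitive X := by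
  intro x O hO
  obtain ⟨k, rfl⟩ := hhom p x
  have hev := hhom.eventually_nearlyReaches hp (isOpen_interior.preimage k.continuous)
    (mem_interior_iff_mem_nhds.2 hO)
  have hcont := k.symm.continuous.tendsto (k p)
  rw [k.symm_apply_apply] at hcont
  filter_upwards [hcont.eventually hev] with y hy
  have := hy.image k
  rw [k.apply_symm_apply] at this
  exact this.mono (by rw [image_preimage_eq _ k.surjective]; exact interior_subset)

end Baire

/-! ### Topology of the open cone -/

section Cone

variable {Y : Type u}

/-- The distance of a point of the cone from the vertex. -/
def coneLevel : OpenCone Y → ℝ≥0 :=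
  Quotient.lift Prod.snd (by
    rintro p q (rfl | ⟨hp, hq⟩)
    · rfl
    · rw [hp, hq])

/-- The point of the cone on the ray through `p.1`, at distance `p.2` from the vertex. -/
def coneMk (p : Y × ℝ≥0) : OpenCone Y := Quotient.mk (openConeSetoid Y) p

@[simp]
theorem coneLevel_coneMk (p : Y × ℝ≥0) : coneLevel (coneMk p) = p.2 := rfl

theorem exists_coneMk_eq (z : OpenCone Y) : ∃ p, coneMk p = z := Quotient.exists_rep z

theorem coneMk_eq_of_level_eq_zero {p : Y × ℝ≥0} {z : OpenCone Y} (hp : p.2 = 0)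
    (hz : coneLevel z = 0) : coneMk p = z := by
  obtain ⟨q, rfl⟩ := exists_coneMk_eq z
  exact Quotient.sound (Or.inr ⟨hp, hz⟩)

theorem coneMk_injOn {p q : Y × ℝ≥0} (hp : p.2 ≠ 0) (h : coneMk p = coneMk q) : p = q := by
  rcases Quotient.exact h with h | h
  · exact h
  · exact absurd h.1 hp

/-- The map of the cone that changes the distance from the vertex by `ρ`. -/
def coneMap (ρ : ℝ≥0 → ℝ≥0) (hρ : ρ 0 = 0) : OpenCone Y → OpenCone Y :=
  Quotient.map (fun p => (p.1, ρ p.2)) (by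
    rintro p q (rfl | ⟨hp, hq⟩)
    · exact Or.inl rfl
    · exact Or.inr ⟨by rw [hp, hρ], by rw [hq, hρ]⟩)

theorem coneMap_coneMk (ρ : ℝ≥0 → ℝ≥0) (hρ : ρ 0 = 0) (p : Y × ℝ≥0) :
    coneMap ρ hρ (coneMk p) = coneMk (p.1, ρ p.2) := rfl

theorem coneLevel_coneMap (ρ : ℝ≥0 → ℝ≥0) (hρ : ρ 0 = 0) (z : OpenCone Y) :
    coneLevel (coneMap ρ hρ z) = ρ (coneLevel z) := by
  obtain ⟨p, rfl⟩ := exists_coneMk_eq z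
  rfl

theorem coneMap_eq_self {ρ : ℝ≥0 → ℝ≥0} (hρ : ρ 0 = 0) {z : OpenCone Y}
    (hz : ρ (coneLevel z) = coneLevel z) : coneMap ρ hρ z = z := by
  obtain ⟨p, rfl⟩ := exists_coneMk_eq z
  rw [coneLevel_coneMk] at hz
  rw [coneMap_coneMk, hz]

/-- The exponential function as a map to the half-line. -/
noncomputable def expNNReal (t : ℝ) : ℝ≥0 := ⟨Real.exp t, (Real.exp_pos t).le⟩

theorem expNNReal_pos (t : ℝ) : 0 < expNNReal t := Real.exp_pos t

theorem exists_expNNReal_eq {s : ℝ≥0} (hs : s ≠ 0) : ∃ t, expNNReal t = s :=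
  ⟨Real.log s, NNReal.eq (Real.exp_log (NNReal.coe_pos.2 (pos_iff_ne_zero.2 hs)))⟩

/-- The complement of the vertex in a cone, as a product with a line. -/
noncomputable def coneCylinder (p : Y × ℝ) : OpenCone Y := coneMk (p.1, expNNReal p.2)

theorem exists_coneCylinder_eq {z : OpenCone Y} (hz : coneLevel z ≠ 0) :
    ∃ p, coneCylinder p = z := by
  obtain ⟨⟨y, s⟩, rfl⟩ := exists_coneMk_eq z
  obtain ⟨t, rfl⟩ := exists_expNNReal_eq hz
  exact ⟨(y, t), rfl⟩

variable [TopologicalSpace Y]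

theorem continuous_coneMk : Continuous (coneMk : Y × ℝ≥0 → OpenCone Y) := continuous_quotient_mk'

theorem isQuotientMap_coneMk : IsQuotientMap (coneMk : Y × ℝ≥0 → OpenCone Y) :=
  isQuotientMap_quotient_mk'

theorem continuous_coneLevel : Continuous (coneLevel : OpenCone Y → ℝ≥0) :=
  continuous_snd.quotient_lift _

theorem continuous_coneMap {ρ : ℝ≥0 → ℝ≥0} (hc : Continuous ρ) (hρ : ρ 0 = 0) :
    Continuous (coneMap ρ hρ : OpenCone Y → OpenCone Y) := by
  refine isQuotientMap_coneMk.continuous_iff.2 (continuous_coneMk.comp ?_)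
  fun_prop

/-- A homeomorphism of the half-line fixing zero induces a homeomorphism of the cone. -/
def coneHomeomorph (ρ : ℝ≥0 ≃ₜ ℝ≥0) (hρ : ρ 0 = 0) : OpenCone Y ≃ₜ OpenCone Y where
  toFun := coneMap ρ hρ
  invFun := coneMap ρ.symm (by rw [Homeomorph.symm_apply_eq, hρ])
  left_inv z := by
    obtain ⟨p, rfl⟩ := exists_coneMk_eq z
    simp [coneMap_coneMk]
  right_inv z := by
    obtain ⟨p, rfl⟩ := exists_coneMk_eq z
    simp [coneMap_coneMk]
  continuous_toFun := continuous_coneMap ρ.continuous hρ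
  continuous_invFun := continuous_coneMap ρ.symm.continuous _

/-- Compactness of `Y` enters through the tube lemma: without it the sublevel sets need not form a
neighborhood basis of the vertex. -/
theorem exists_coneLevel_lt_subset [CompactSpace Y] {v : OpenCone Y} (hv : coneLevel v = 0)
    {O : Set (OpenCone Y)} (hO : O ∈ 𝓝 v) : ∃ s > 0, {z | coneLevel z < s} ⊆ O := by
  obtain ⟨U, hUO, hU, hvU⟩ := mem_nhds_iff.1 hO
  obtain ⟨A, B, -, hB, hA, h0B, hAB⟩ := generalized_tube_lemma (isCompact_univ (X := Y))
    (isCompact_singleton (x := (0 : ℝ≥0))) (hU.preimage continuous_coneMk) (by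
      rintro ⟨y, t⟩ ⟨-, rfl⟩
      rw [mem_preimage, coneMk_eq_of_level_eq_zero rfl hv]
      exact hvU)
  have hBn : B ∈ 𝓝 (0 : ℝ≥0) := hB.mem_nhds (singleton_subset_iff.1 h0B)
  obtain ⟨s, hs, hsB⟩ := (nhds_bot_basis (α := ℝ≥0)).mem_iff.1 hBn
  refine ⟨s, hs, fun z hz => hUO ?_⟩
  obtain ⟨⟨y, t⟩, rfl⟩ := exists_coneMk_eq z
  exact hAB ⟨hA (mem_univ y), hsB hz⟩

theorem isCompact_coneLevel_le [CompactSpace Y] (s : ℝ≥0) :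
    IsCompact {z : OpenCone Y | coneLevel z ≤ s} := by
  have : {z : OpenCone Y | coneLevel z ≤ s} = coneMk '' (univ ×ˢ Icc 0 s) := by
    ext z
    constructor
    · intro hz
      obtain ⟨p, rfl⟩ := exists_coneMk_eq z
      exact ⟨p, ⟨mem_univ _, zero_le, hz⟩, rfl⟩
    · rintro ⟨p, ⟨-, -, hp⟩, rfl⟩
      exact hp
  rw [this]
  exact (isCompact_univ.prod isCompact_Icc).image continuous_coneMk

theorem isOpen_coneLevel_lt (s : ℝ≥0) : IsOpen {z : OpenCone Y | coneLevel z < s} :=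
  isOpen_Iio.preimage continuous_coneLevel

theorem isOpenEmbedding_expNNReal : IsOpenEmbedding expNNReal := by
  have hcomp : ((↑) : ℝ≥0 → ℝ) ∘ expNNReal = Real.exp := rfl
  refine .of_continuous_injective_isOpenMap
    (Real.continuous_exp.subtype_mk _) (fun a b hab => Real.exp_injective (congrArg NNReal.toReal hab)) ?_
  intro U hU
  have : expNNReal '' U = ((↑) : ℝ≥0 → ℝ) ⁻¹' (Real.exp '' U) := by
    rw [← hcomp, image_comp, preimage_image_eq _ NNReal.coe_injective]
  rw [this]
  exact (Real.isOpenEmbedding_exp.isOpenMap U hU).preimage NNReal.continuous_coe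

/-- Off the vertex the quotient map is injective, so open sets there are saturated. -/
theorem isOpenEmbedding_coneCylinder : IsOpenEmbedding (coneCylinder : Y × ℝ → OpenCone Y) := by
  have hE : IsOpenEmbedding (Prod.map id expNNReal : Y × ℝ → Y × ℝ≥0) :=
    IsOpenEmbedding.id.prodMap isOpenEmbedding_expNNReal
  refine .of_continuous_injective_isOpenMap (continuous_coneMk.comp hE.continuous) ?_ ?_
  · exact fun p q hpq => hE.injective (coneMk_injOn (expNNReal_pos _).ne' hpq)
  · intro U hU
    have : coneMk ⁻¹' (coneCylinder '' U) = Prod.map id expNNReal '' U := by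
      ext p
      constructor
      · rintro ⟨q, hq, hqp⟩
        exact ⟨q, hq, coneMk_injOn (expNNReal_pos _).ne' hqp⟩
      · rintro ⟨q, hq, rfl⟩
        exact ⟨q, hq, rfl⟩
    rw [← isQuotientMap_coneMk.isOpen_preimage, this]
    exact hE.isOpenMap U hU

end Cone

/-! ### Radial contractions of the half-line -/

section Radial

/-- A homeomorphism of the half-line that moves points below `s` towards zero. -/
noncomputable def radialMap (s : ℝ≥0) (e : ℝ) (t : ℝ≥0) : ℝ≥0 := if t ≤ s then s * (t / s) ^ e else t

theorem radialMap_zero {s : ℝ≥0} {e : ℝ} (he : 0 < e) : radialMap s e 0 = 0 := by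
  simp [radialMap, NNReal.zero_rpow he.ne']

theorem radialMap_of_le {s t : ℝ≥0} (hs : 0 < s) {e : ℝ} (ht : s ≤ t) : radialMap s e t = t := by
  rcases ht.eq_or_lt with rfl | h
  · simp [radialMap, div_self hs.ne']
  · simp [radialMap, not_le.2 h]

theorem continuous_radialMap {s : ℝ≥0} (hs : 0 < s) {e : ℝ} (he : 0 < e) :
    Continuous (radialMap s e) := by
  refine Continuous.if_le ?_ continuous_id continuous_id continuous_const ?_
  · exact continuous_const.mul ((NNReal.continuous_rpow_const he.le).comp (continuous_id.div_const s))
  · rintro t rfl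
    simp [div_self hs.ne']

theorem radialMap_radialMap {s : ℝ≥0} (hs : 0 < s) {e f : ℝ} (he : 0 < e) (hef : e * f = 1)
    (t : ℝ≥0) : radialMap s f (radialMap s e t) = t := by
  rcases le_or_gt t s with ht | ht
  · have h1 : (t / s) ^ e ≤ 1 := NNReal.rpow_le_one (div_le_one_of_le₀ ht zero_le) he.le
    have h2 : s * (t / s) ^ e ≤ s := mul_le_of_le_one_right' h1
    rw [radialMap, radialMap, if_pos ht, if_pos h2, mul_div_cancel_left₀ _ hs.ne',
      ← NNReal.rpow_mul, hef, NNReal.rpow_one, mul_div_cancel₀ _ hs.ne']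
  · rw [radialMap_of_le hs ht.le, radialMap_of_le hs ht.le]

/-- Since `t / s < 1`, a large power of it is small. The exponent is `n + 1` to keep it positive;
the inverse map uses the reciprocal exponent. -/
theorem exists_homeomorph_nnreal {s : ℝ≥0} (hs : 0 < s) {t ε : ℝ≥0} (ht : t < s) (hε : 0 < ε) :
    ∃ ρ : ℝ≥0 ≃ₜ ℝ≥0, ρ 0 = 0 ∧ (∀ r, s ≤ r → ρ r = r) ∧ ρ t < ε := by
  have hlim : Tendsto (fun n : ℕ => s * (t / s) ^ (n + 1)) atTop (𝓝 0) := by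
    have h1 := (tendsto_pow_atTop_nhds_zero_of_lt_one (zero_le (a := t / s))
      ((div_lt_one hs).2 ht)).const_mul s
    rw [mul_zero] at h1
    exact h1.comp (tendsto_add_atTop_nat 1)
  obtain ⟨n, hn⟩ := (hlim.eventually (gt_mem_nhds hε)).exists
  have he : (0 : ℝ) < ((n + 1 : ℕ) : ℝ) := by positivity
  have hef : ((n + 1 : ℕ) : ℝ) * ((n + 1 : ℕ) : ℝ)⁻¹ = 1 := mul_inv_cancel₀ he.ne'
  refine ⟨⟨⟨radialMap s (n + 1 : ℕ), radialMap s ((n + 1 : ℕ) : ℝ)⁻¹,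
    radialMap_radialMap hs he hef, radialMap_radialMap hs (inv_pos.2 he) (by rw [mul_comm, hef])⟩,
    continuous_radialMap hs he, continuous_radialMap hs (inv_pos.2 he)⟩,
    radialMap_zero he, fun r hr => radialMap_of_le hs hr, ?_⟩
  change radialMap s (n + 1 : ℕ) t < ε
  rwa [radialMap, if_pos ht.le, NNReal.rpow_natCast]

end Radial

/-! ### Extension by the identity -/

section Extension

variable {X E : Type u} [TopologicalSpace X] [TopologicalSpace E] [T2Space X]

/-- In a Hausdorff space `ψ '' K` is closed, so the extension is the identity near every point
outside `range ψ`. -/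
theorem continuous_extend_of_eqOn_compl {ψ : E → X} (hψ : IsOpenEmbedding ψ) {g : E → E}
    (hg : Continuous g) {K : Set E} (hK : IsCompact K) (hgK : ∀ z ∉ K, g z = z) :
    Continuous (Function.extend ψ (ψ ∘ g) id) := by
  rw [continuous_iff_continuousAt]
  intro x
  by_cases hx : x ∈ range ψ
  · obtain ⟨z, rfl⟩ := hx
    rw [← hψ.continuousAt_iff, Function.extend_comp hψ.injective]
    exact (hψ.continuous.comp hg).continuousAt
  · have hopen : (ψ '' K)ᶜ ∈ 𝓝 x := (hK.image hψ.continuous).isClosed.isOpen_compl.mem_nhds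
      fun hxK => hx (image_subset_range _ _ hxK)
    refine continuousAt_id.congr ?_
    filter_upwards [hopen] with y hy
    by_cases hyr : ∃ z, ψ z = y
    · obtain ⟨z, rfl⟩ := hyr
      rw [hψ.injective.extend_apply, Function.comp_apply, hgK z fun hz => hy ⟨z, hz, rfl⟩, id]
    · rw [Function.extend_apply' _ _ _ hyr]

/-- A homeomorphism with compact support of an open subspace extends by the identity. -/
theorem exists_homeomorph_extension {ψ : E → X} (hψ : IsOpenEmbedding ψ) (g : E ≃ₜ E) {K : Set E}
    (hK : IsCompact K) (hgK : IsSupportedIn g K) :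
    ∃ h : X ≃ₜ X, (∀ z, h (ψ z) = ψ (g z)) ∧ ∀ x ∉ range ψ, h x = x := by
  have key : ∀ g₁ g₂ : E → E, (∀ z, g₁ (g₂ z) = z) → ∀ x,
      Function.extend ψ (ψ ∘ g₁) id (Function.extend ψ (ψ ∘ g₂) id x) = x := by
    intro g₁ g₂ hg x
    by_cases hx : ∃ z, ψ z = x
    · obtain ⟨z, rfl⟩ := hx
      simp [hψ.injective.extend_apply, hg]
    · rw [Function.extend_apply' _ _ x hx, id, Function.extend_apply' _ _ x hx, id]
  exact ⟨⟨⟨Function.extend ψ (ψ ∘ g) id, Function.extend ψ (ψ ∘ g.symm) id,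
    key _ _ g.symm_apply_apply, key _ _ g.apply_symm_apply⟩,
    continuous_extend_of_eqOn_compl hψ g.continuous hK hgK,
    continuous_extend_of_eqOn_compl hψ g.symm.continuous hK hgK.symm⟩,
    fun z => hψ.injective.extend_apply _ _ z,
    fun x hx => Function.extend_apply' _ _ x hx⟩

end Extension

/-! ### Attraction to the vertex and punctured neighborhoods -/

section ConeCharts

variable {X Y : Type u} [TopologicalSpace X] [TopologicalSpace Y]

theorem isLocallyAttracting_vertex [T2Space X] [CompactSpace Y] {ψ : OpenCone Y → X}
    (hψ : IsOpenEmbedding ψ) {v : OpenCone Y} (hv : coneLevel v = 0) :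
    IsLocallyAttracting (ψ v) := by
  intro O hO
  obtain ⟨s, hs, hsO⟩ := exists_coneLevel_lt_subset hv (hψ.continuous.continuousAt hO)
  have hopen : IsOpen (ψ '' {z | coneLevel z < s}) := hψ.isOpenMap _ (isOpen_coneLevel_lt s)
  refine ⟨ψ '' {z | coneLevel z < s}, hopen.mem_nhds (mem_image_of_mem _ ?_),
    image_subset_iff.2 hsO, hopen, ?_⟩
  · rw [mem_ofPred_eq, hv]
    exact hs
  rintro _ ⟨z, hz, rfl⟩ N hN
  obtain ⟨ε, hε, hεN⟩ := exists_coneLevel_lt_subset hv (hψ.continuous.continuousAt hN)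
  obtain ⟨ρ, hρ0, hρs, hρz⟩ := exists_homeomorph_nnreal hs hz hε
  obtain ⟨h, hh, hhr⟩ := exists_homeomorph_extension hψ (coneHomeomorph ρ hρ0)
    (isCompact_coneLevel_le s) fun w hw => coneMap_eq_self hρ0 (hρs _ (not_le.1 hw).le)
  refine ⟨h, fun x hx => ?_, ?_⟩
  · by_cases hxr : x ∈ range ψ
    · obtain ⟨w, rfl⟩ := hxr
      rw [hh w]
      exact congrArg ψ (coneMap_eq_self hρ0
        (hρs _ (not_lt.1 fun hw => hx (mem_image_of_mem ψ hw))))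
    · exact hhr x hxr
  · rw [hh z]
    refine hεN ?_
    rw [mem_ofPred_eq]
    exact (coneLevel_coneMap ρ hρ0 z).trans_lt hρz

theorem hasPreconnectedPuncturedNhds_vertex [CompactSpace Y] [PreconnectedSpace Y]
    {v : OpenCone Y} (hv : coneLevel v = 0) : HasPreconnectedPuncturedNhds v := by
  intro O hO
  obtain ⟨s, hs, hsO⟩ := exists_coneLevel_lt_subset hv hO
  refine ⟨{z | coneLevel z < s}, (isOpen_coneLevel_lt s).mem_nhds (by rwa [mem_ofPred_eq, hv]),
    hsO, ?_⟩
  have : {z : OpenCone Y | coneLevel z < s} \ {v} = coneMk '' (univ ×ˢ Ioo 0 s) := by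
    ext z
    constructor
    · rintro ⟨hz, hzv⟩
      obtain ⟨p, rfl⟩ := exists_coneMk_eq z
      exact ⟨p, ⟨mem_univ _, pos_iff_ne_zero.2 fun hp => hzv (coneMk_eq_of_level_eq_zero hp hv),
        hz⟩, rfl⟩
    · rintro ⟨p, ⟨-, hp0, hps⟩, rfl⟩
      refine ⟨hps, fun hpv => hp0.ne' ?_⟩
      rw [mem_singleton_iff] at hpv
      rw [← hv, ← hpv, coneLevel_coneMk]
  rw [this]
  exact (isPreconnected_univ.prod isPreconnected_Ioo).image _ continuous_coneMk.continuousOn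

/-- A small punctured neighborhood of the vertex projects onto `Y`, because it contains a full level
`s / 2`. -/
theorem preconnectedSpace_of_hasPreconnectedPuncturedNhds [CompactSpace Y] {ψ : OpenCone Y → X}
    (hψ : IsOpenEmbedding ψ) {v : OpenCone Y} (hv : coneLevel v = 0)
    (h : HasPreconnectedPuncturedNhds (ψ v)) : PreconnectedSpace Y := by
  obtain ⟨V, hV, hVr, hVc⟩ := h (range ψ) (hψ.isOpen_range.mem_nhds (mem_range_self v))
  have hχ : IsOpenEmbedding (ψ ∘ coneCylinder) := hψ.comp isOpenEmbedding_coneCylinder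
  have hsub : V \ {ψ v} ⊆ range (ψ ∘ coneCylinder) := by
    rintro x ⟨hx, hxv⟩
    obtain ⟨z, rfl⟩ := hVr hx
    obtain ⟨p, rfl⟩ := exists_coneCylinder_eq (z := z) fun hz => hxv (by
      obtain ⟨q, rfl⟩ := exists_coneMk_eq z
      rw [mem_singleton_iff, coneMk_eq_of_level_eq_zero hz hv])
    exact ⟨p, rfl⟩
  rw [← image_preimage_eq_of_subset hsub, hχ.isInducing.isPreconnected_image] at hVc
  obtain ⟨s, hs, hsV⟩ := exists_coneLevel_lt_subset hv (hψ.continuous.continuousAt hV)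
  refine ⟨?_⟩
  have himage : Prod.fst '' ((ψ ∘ coneCylinder) ⁻¹' (V \ {ψ v})) = (univ : Set Y) := by
    refine eq_univ_of_forall fun y => ?_
    obtain ⟨t, ht⟩ := exists_expNNReal_eq (half_pos hs).ne'
    have hlevel : coneLevel (coneCylinder (y, t)) = s / 2 := ht
    refine ⟨(y, t), ⟨hsV ?_, fun hyv => ?_⟩, rfl⟩
    · rw [mem_ofPred_eq, hlevel]
      exact NNReal.half_lt_self hs.ne'
    · have := hψ.injective hyv
      rw [this, hv] at hlevel
      exact (half_pos hs).ne hlevel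
  rw [← himage]
  exact hVc.image _ continuous_fst.continuousOn

/-- In a connected box, vertical and horizontal slices missing `(y, t)` link every other point to
`(y', t')`; non-isolation of `y` and `t` supplies `y'` and `t'`. -/
theorem hasPreconnectedPuncturedNhds_prod {T : Type*} [TopologicalSpace T]
    [LocallyConnectedSpace Y] [LocallyConnectedSpace T] {y : Y} {t : T} (hy : ¬ IsOpen {y})
    (ht : ¬ IsOpen {t}) : HasPreconnectedPuncturedNhds (y, t) := by
  intro O hO
  obtain ⟨A', hA', B', hB', hAB'⟩ := mem_nhds_prod_iff.1 hO
  obtain ⟨A, hAA', hAo, hyA, hA⟩ :=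
    locallyConnectedSpace_iff_subsets_isOpen_isConnected.1 inferInstance y A' hA'
  obtain ⟨B, hBB', hBo, htB, hB⟩ :=
    locallyConnectedSpace_iff_subsets_isOpen_isConnected.1 inferInstance t B' hB'
  refine ⟨A ×ˢ B, prod_mem_nhds (hAo.mem_nhds hyA) (hBo.mem_nhds htB),
    (prod_mono hAA' hBB').trans hAB', ?_⟩
  obtain ⟨y', hy'A, hy'⟩ : ∃ y' ∈ A, y' ≠ y := by
    by_contra! hn
    exact hy ((eq_singleton_iff_unique_mem.2 ⟨hyA, hn⟩) ▸ hAo)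
  obtain ⟨t', ht'B, ht'⟩ : ∃ t' ∈ B, t' ≠ t := by
    by_contra! hn
    exact ht ((eq_singleton_iff_unique_mem.2 ⟨htB, hn⟩) ▸ hBo)
  have hvert : ∀ a, IsPreconnected (({a} : Set Y) ×ˢ B) := fun a =>
    isPreconnected_singleton.prod hB.isPreconnected
  have hhor : ∀ b, IsPreconnected (A ×ˢ ({b} : Set T)) := fun b =>
    hA.isPreconnected.prod isPreconnected_singleton
  have vsub : ∀ a ∈ A, a ≠ y → ({a} : Set Y) ×ˢ B ⊆ A ×ˢ B \ {(y, t)} := by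
    rintro a ha hay ⟨a', b⟩ ⟨rfl, hb⟩
    exact ⟨⟨ha, hb⟩, fun h => hay (congrArg Prod.fst h)⟩
  have hsub : ∀ b ∈ B, b ≠ t → A ×ˢ ({b} : Set T) ⊆ A ×ˢ B \ {(y, t)} := by
    rintro b hb hbt ⟨a, b'⟩ ⟨ha, rfl⟩
    exact ⟨⟨ha, hb⟩, fun h => hbt (congrArg Prod.snd h)⟩
  refine isPreconnected_of_forall (y', t') ?_
  rintro ⟨a, b⟩ ⟨⟨ha, hb⟩, hab⟩
  by_cases hay : a = y
  · have hbt : b ≠ t := fun hbt => hab (by rw [hay, hbt]; rfl)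
    refine ⟨{y'} ×ˢ B ∪ A ×ˢ {b}, union_subset (vsub y' hy'A hy') (hsub b hb hbt),
      Or.inl ⟨rfl, ht'B⟩, Or.inr ⟨ha, rfl⟩, ?_⟩
    exact (hvert y').union (y', b) ⟨rfl, hb⟩ ⟨hy'A, rfl⟩ (hhor b)
  · refine ⟨A ×ˢ {t'} ∪ {a} ×ˢ B, union_subset (hsub t' ht'B ht') (vsub a ha hay),
      Or.inl ⟨hy'A, rfl⟩, Or.inr ⟨rfl, hb⟩, ?_⟩
    exact (hhor t').union (a, t') ⟨ha, rfl⟩ ⟨rfl, ht'B⟩ (hvert a)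

theorem locallyConnectedSpace_of_prod {T : Type*} [TopologicalSpace T] [Nonempty T]
    [LocallyConnectedSpace (Y × T)] : LocallyConnectedSpace Y := by
  refine locallyConnectedSpace_iff_subsets_isOpen_isConnected.2 fun y U hU => ?_
  obtain ⟨t⟩ := ‹Nonempty T›
  obtain ⟨V, hVU, hV, hyV, hVc⟩ := locallyConnectedSpace_iff_subsets_isOpen_isConnected.1
    inferInstance (y, t) (Prod.fst ⁻¹' U) (continuous_fst.continuousAt hU)
  exact ⟨Prod.fst '' V, image_subset_iff.2 hVU, isOpenMap_fst V hV, ⟨_, hyV, rfl⟩,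
    hVc.image _ continuous_fst.continuousOn⟩

end ConeCharts

/-! ### Excluding the one-dimensional case -/

section Manifold

variable {X : Type u} [TopologicalSpace X]

theorem IsHomogeneousSpace.isTopologicalManifold [T2Space X] [SecondCountableTopology X]
    (hhom : IsHomogeneousSpace X) {c : ℝ → X} (hc : IsOpenEmbedding c) :
    IsTopologicalManifold X := by
  refine ⟨inferInstance, inferInstance, 1, ?_⟩
  choose h hh using hhom (c 0)
  let e : EuclideanSpace ℝ (Fin 1) ≃ₜ ℝ :=
    (EuclideanSpace.equiv (Fin 1) ℝ).toHomeomorph.trans (Homeomorph.funUnique (Fin 1) ℝ)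
  have hemb : ∀ x, IsOpenEmbedding (h x ∘ c ∘ e) := fun x =>
    (h x).isOpenEmbedding.comp (hc.comp e.isOpenEmbedding)
  let chart : X → OpenPartialHomeomorph X (EuclideanSpace ℝ (Fin 1)) := fun x =>
    ((hemb x).toOpenPartialHomeomorph _).symm
  refine ⟨⟨range chart, chart, fun x => ?_, mem_range_self⟩⟩
  have : x ∈ range (h x ∘ c ∘ e) := ⟨e.symm 0, by
    rw [Function.comp_apply, Function.comp_apply, e.apply_symm_apply, hh]⟩
  simpa [chart] using this

theorem IsHomogeneousSpace.hasPreconnectedPuncturedNhds [T2Space X] [SecondCountableTopology X]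
    [LocallyConnectedSpace X] (hhom : IsHomogeneousSpace X) (hX : ¬ IsTopologicalManifold X)
    {Y : Type u} [TopologicalSpace Y] [CompactSpace Y] {ψ : OpenCone Y → X}
    (hψ : IsOpenEmbedding ψ) {v : OpenCone Y} (hv : coneLevel v = 0) (x : X) :
    HasPreconnectedPuncturedNhds x := by
  suffices hY : PreconnectedSpace Y by
    obtain ⟨h, rfl⟩ := hhom (ψ v) x
    exact ((hasPreconnectedPuncturedNhds_vertex hv).map hψ).map h.isOpenEmbedding
  have hχ : IsOpenEmbedding (ψ ∘ coneCylinder) := hψ.comp isOpenEmbedding_coneCylinder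
  have : LocallyConnectedSpace (Y × ℝ) := hχ.locallyConnectedSpace
  have : LocallyConnectedSpace Y := locallyConnectedSpace_of_prod (T := ℝ)
  obtain ⟨⟨y, -⟩, -⟩ := exists_coneMk_eq v
  -- An isolated `y` would make the ray through it an open line in `X`.
  have hy : ¬ IsOpen {y} := fun hy => by
    refine hX (hhom.isTopologicalManifold (c := fun t => (ψ ∘ coneCylinder) (y, t)) ?_)
    refine hχ.comp (.of_continuous_injective_isOpenMap (by fun_prop) (Prod.mk_right_injective y) ?_)
    intro U hU
    have : Prod.mk y '' U = {y} ×ˢ U := singleton_prod.symm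
    rw [this]
    exact hy.prod hU
  have ht : ¬ IsOpen {(0 : ℝ)} := not_isOpen_singleton 0
  have hyp := (hasPreconnectedPuncturedNhds_prod hy ht).map hχ
  -- Homogeneity carries the property from a point on a ray to the vertex, where it forces `Y` to be
  -- connected.
  obtain ⟨h, hh⟩ := hhom ((ψ ∘ coneCylinder) (y, 0)) (ψ v)
  exact preconnectedSpace_of_hasPreconnectedPuncturedNhds hψ hv
    (hh ▸ hyp.map h.isOpenEmbedding)

end Manifold

/-! ### Topological properties of Euclidean neighborhood retracts -/

section Retracts

variable {E : Type*} [TopologicalSpace E] {R W : Set E}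

/-- `R` is the fixed point set of the retraction, hence closed in the open set `W`. -/
theorem IsRetractOf.isLocallyClosed [T2Space E] (hR : IsRetractOf R W) (hW : IsOpen W) :
    IsLocallyClosed R := by
  obtain ⟨hRW, r, hr, hrR, hrx⟩ := hR
  have hcl : IsClosed {x : W | r x = x} :=
    isClosed_eq (continuousOn_iff_continuous_domRestrict.1 hr) continuous_subtype_val
  have himg : ((↑) : W → E) '' {x : W | r x = x} = R := by
    ext x
    constructor
    · rintro ⟨y, hy, rfl⟩
      rw [mem_ofPred_eq] at hy
      exact hy ▸ hrR y.2
    · exact fun hx => ⟨⟨x, hRW hx⟩, hrx x hx, rfl⟩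
  rw [← himg]
  exact hcl.isLocallyClosed.image IsInducing.subtypeVal (by simpa using hW.isLocallyClosed)

/-- A retraction is a quotient map, and local path connectedness passes to quotients. -/
theorem IsRetractOf.locallyPathConnectedSpace [LocallyPathConnectedSpace E]
    (hR : IsRetractOf R W) (hW : IsOpen W) : LocallyPathConnectedSpace R := by
  obtain ⟨hRW, r, hr, hrR, hrx⟩ := hR
  have := hW.locallyPathConnectedSpace
  have hq : IsQuotientMap (hrR.restrict r W R) :=
    .of_comp (continuous_inclusion hRW) (hr.mapsToRestrict hrR) (by
      have : hrR.restrict r W R ∘ inclusion hRW = id := by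
        ext x
        exact hrx x x.2
      rw [this]
      exact .id)
  exact hq.locallyPathConnectedSpace

theorem IsLocallyClosed.polishSpace [PolishSpace E] (hR : IsLocallyClosed R) : PolishSpace R := by
  obtain ⟨U, Z, hU, hZ, rfl⟩ := hR
  have := hU.polishSpace
  refine IsClosedEmbedding.polishSpace (f := inclusion (inter_subset_left (s := U) (t := Z)))
    ⟨.inclusion inter_subset_left, ?_⟩
  rw [range_inclusion]
  convert hZ.preimage (continuous_subtype_val (p := (· ∈ U))) using 1
  ext x
  simp

end Retracts

/-! ### The main theorem -/

theorem corollary2 {X : Type u} [TopologicalSpace X]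
    (hconical : IsLocallyConical X) (hhom : IsHomogeneousSpace X)
    (henr : IsEuclideanNhdRetract X) (hnot : ¬ IsTopologicalManifold X) :
    (∀ x : X, ∀ n : ℕ, 2 ≤ n → IsStronglyHomogeneous n (connectedComponent x)) ∧
      IsCountableDenseHomogeneous X := by
  obtain ⟨m, -, W, R, hW, hR, ⟨e⟩⟩ := henr
  have hRl := hR.isLocallyClosed hW
  have := hRl.polishSpace
  have := hRl.locallyCompactSpace
  have := hR.locallyPathConnectedSpace hW
  have : LocallyConnectedSpace X := e.locallyConnectedSpace
  have : LocallyCompactSpace X := e.isClosedEmbedding.locallyCompactSpace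
  have : PolishSpace X := e.isClosedEmbedding.polishSpace
  let := TopologicalSpace.upgradeIsCompletelyMetrizable X
  rcases isEmpty_or_nonempty X with hX | ⟨⟨x₀⟩⟩
  · exact ⟨fun x => isEmptyElim x, fun A B _ _ _ _ =>
      ⟨Homeomorph.refl X, Subsingleton.elim _ _⟩⟩
  obtain ⟨U, hU, hx₀, Y, _, hY, ⟨φ⟩⟩ := hconical x₀
  have hψ : IsOpenEmbedding (Subtype.val ∘ φ.symm) :=
    hU.isOpenEmbedding_subtypeVal.comp φ.symm.isOpenEmbedding
  -- The point `x₀` may differ from the vertex; it only shows that `Y` is nonempty, so that a vertex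
  -- exists.
  obtain ⟨⟨y, -⟩, -⟩ := exists_coneMk_eq (φ ⟨x₀, hx₀⟩)
  have hv : coneLevel (coneMk (y, 0)) = 0 := rfl
  have hS : StronglyLocallyHomogeneous X :=
    (hhom.nearlyMicrotransitive (isLocallyAttracting_vertex hψ hv)).stronglyLocallyHomogeneous
  have hpunct := hhom.hasPreconnectedPuncturedNhds hnot hψ hv
  exact ⟨fun x n _ => hS.isStronglyHomogeneous isOpen_connectedComponent
    (isPreconnected_diff_of_finite hpunct isOpen_connectedComponent
      isPreconnected_connectedComponent) n, hS.isCountableDenseHomogeneous⟩
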